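/- Model. There are $k=m$ objects $o_0,\dots,o_{m-1}$ and $2m$ cache nodes, $A=\{a_0,\dots,a_{m-1}\}$ and $B=\{b_0,\dots,b_{m-1}\}$. Queries for $o_i$ arrive as a Poisson process of rate $p_iR$, where $R>0$ and $P=(p_i)$ is a probability distribution; each node has a queue that is served at exponential rate $\widetilde T$; all these clocks are independent. Given a rule that routes each query to a node, the vector of the $2m$ queue lengths is a continuous-time Markov process. The system is called stationary if this process has a stationary distribution, and non-stationary otherwise. In the *uniform algorithm* (one hash function) $h:\{0,\dots,m-1\}\to A\cup B$ is a uniformly random function and every query for $o_i$ is sent to $h(i)$. In the *power-of-two-choices (PoT) algorithm*, $h_0,h_1:\{0,\dots,m-1\}\to\{0,\dots,m-1\}$ are independent uniformly random functions and every query for $o_i$ is sent to the node with the shorter queue among $a_{h_0(i)}$ and $b_{h_1(i)}$, ties being broken by a fair coin. Probabilities below are over the hash functions. Suppose that all objects have the same rate $p_iR=r>0$ and that $\widetilde T=c\,r$ for a constant $c$. 1. For every $c>0$ there are $\delta>0$ and $m_0$, depending only on $c$, such that for all $m\ge m_0$ and all such $r$, $P$, $R$, $\widetilde T$, the system with the uniform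 algorithm is non-stationary with probability at least $\delta$. Moreover, for each fixed node $v\in A\cup B$, with probability at least $\delta$ the following hold together: there is a set $S$ of at least $c+1$ objects that are all hashed to $v$ and satisfy $\sum_{i\in S}p_iR>\widetilde T$ (so $v$ is overloaded), and the system is non-stationary. 2. For every $c\ge 2$, that is, $\max_i p_iR\le\widetilde T/2$, the system with the PoT algorithm is stationary with probability $1-o(1)$ as $m\to\infty$, where the $o(1)$ depends only on $c$ and $m$: for every $\varepsilon>0$ there is $m_0$ such that for all $m\ge m_0$ and all such $r$, $P$, $R$, $\widetilde T$ this probability is at least $1-\varepsilon$. -/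

import Mathlib

open scoped NNReal ENNReal

/-- The `2m` cache nodes: the upper layer `a_0, …, a_{m-1}` (`Sum.inl`) and the lower layer
`b_0, …, b_{m-1}` (`Sum.inr`). -/
abbrev CacheNode (m : ℕ) : Type := Fin m ⊕ Fin m

/-- The state of the queueing process: the number of queries waiting at every cache node. -/
abbrev QueueState (m : ℕ) : Type := CacheNode m → ℕ

/-- The parameters of the system: `k` objects with query distribution `p`, total query rate `R`
(so that object `i` has query rate `p i * R`), and `2m` cache nodes of throughput `T` each. -/
structure CacheSystem (k m : ℕ) where
  p : Fin k → ℝ≥0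
  sum_p : ∑ i, p i = 1
  R : ℝ≥0
  R_pos : 0 < R
  T : ℝ≥0

/-- A routing rule: the distribution of the node to which a query for a given object is sent when
the queues are in a given state. -/
abbrev RoutingRule (k m : ℕ) : Type := Fin k → QueueState m → PMF (CacheNode m)

/-- Routing with a single hash function: every query for object `i` goes to the node `h i`. -/
noncomputable def uniformRouting {k m : ℕ} (h : Fin k → CacheNode m) : RoutingRule k m :=
  fun i _ => PMF.pure (h i)

/-- Power-of-two-choices routing: a query for object `i` goes to the node with the shorter queue
among `a_{h₀ i}` and `b_{h₁ i}`; ties are broken by a fair coin. -/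
noncomputable def potRouting {k m : ℕ} (h₀ h₁ : Fin k → Fin m) : RoutingRule k m :=
  fun i x =>
    if x (Sum.inl (h₀ i)) < x (Sum.inr (h₁ i)) then PMF.pure (Sum.inl (h₀ i))
    else if x (Sum.inr (h₁ i)) < x (Sum.inl (h₀ i)) then PMF.pure (Sum.inr (h₁ i))
    else PMF.uniformOfFinset {Sum.inl (h₀ i), Sum.inr (h₁ i)} (Finset.insert_nonempty _ _)

namespace CacheSystem

variable {k m : ℕ}

/-- The rate of each of the independent Poisson clocks that drive the process: object `i` is
queried at rate `p i * R`, and each node has a service clock of rate `T`. -/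
def clockRate (sys : CacheSystem k m) : Fin k ⊕ CacheNode m → ℝ≥0 :=
  Sum.elim (fun i => sys.p i * sys.R) (fun _ => sys.T)

/-- The rate at which some clock rings. -/
def totalRate (sys : CacheSystem k m) : ℝ≥0 := ∑ e, sys.clockRate e

theorem totalRate_pos (sys : CacheSystem k m) : 0 < sys.totalRate := by
  have h : sys.totalRate = sys.R + ∑ _v : CacheNode m, sys.T := by
    rw [totalRate, Fintype.sum_sum_type]
    simp only [clockRate, Sum.elim_inl, Sum.elim_inr]
    rw [← Finset.sum_mul, sys.sum_p, one_mul]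
  rw [h]
  exact add_pos_of_pos_of_nonneg sys.R_pos bot_le

/-- When a clock rings, it is clock `e` with probability proportional to the rate of `e`. -/
noncomputable def ringingClock (sys : CacheSystem k m) : PMF (Fin k ⊕ CacheNode m) :=
  PMF.ofFintype (fun e => ((sys.clockRate e / sys.totalRate : ℝ≥0) : ℝ≥0∞)) (by
    rw [← ENNReal.ofNNReal_finsetSum, ← Finset.sum_div]
    have h : (∑ e, sys.clockRate e) / sys.totalRate = 1 := div_self sys.totalRate_pos.ne'
    rw [h, ENNReal.coe_one])

/-- The effect of a ring on the queues: a query for object `i` joins the queue of the node chosen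
by the routing rule; the service clock of node `v` completes the service of one query at `v`, and
has no effect if the queue of `v` is empty. (As exponential times have no memory, the service time
of every query is then exponential with rate `T`.) -/
noncomputable def ringEffect (ρ : RoutingRule k m) (x : QueueState m) :
    Fin k ⊕ CacheNode m → PMF (QueueState m)
  | Sum.inl i => (ρ i x).map (fun v => Function.update x v (x v + 1))
  | Sum.inr v => PMF.pure (Function.update x v (x v - 1))

/-- The distribution of the state after one ring, starting from `x`. -/
noncomputable def afterRing (sys : CacheSystem k m) (ρ : RoutingRule k m) (x : QueueState m) :
    PMF (QueueState m) :=
  sys.ringingClock.bind (ringEffect ρ x)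

/-- The distribution of the state after `n` rings, starting from `x`. -/
noncomputable def afterRings (sys : CacheSystem k m) (ρ : RoutingRule k m) :
    ℕ → QueueState m → PMF (QueueState m)
  | 0, x => PMF.pure x
  | n + 1, x => (sys.afterRings ρ n x).bind (sys.afterRing ρ)

/-- The transition function of the continuous-time Markov process of queue lengths: the
distribution at time `t` of the state of the process started from `x`. The number of rings up to
time `t` is Poisson with mean `totalRate * t` and independent of which clocks ring. -/
noncomputable def lawAt (sys : CacheSystem k m) (ρ : RoutingRule k m) (t : ℝ≥0)
    (x : QueueState m) : PMF (QueueState m) :=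
  (ProbabilityTheory.poissonMeasure (sys.totalRate * t)).toPMF.bind
    (fun n => sys.afterRings ρ n x)

/-- The system is stationary if its Markov process of queue lengths has a stationary
distribution. -/
def IsStationary (sys : CacheSystem k m) (ρ : RoutingRule k m) : Prop :=
  ∃ π : PMF (QueueState m), ∀ t : ℝ≥0, π.bind (sys.lawAt ρ t) = π

end CacheSystem

/-- The probability of an event under the uniform distribution on a finite set. -/
noncomputable def uniformProb {Ω : Type*} [Finite Ω] (E : Set Ω) : ℝ :=
  (E.ncard : ℝ) / (Nat.card Ω : ℝ)

/-! The process jumps at the rings of a Poisson clock, so everything reduces to the discrete chain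
`afterRing`: a distribution invariant for it is invariant for every Poisson mixture `lawAt`, and a
function contracting along it contracts along `lawAt`.

Non-stationarity: the number of objects hashed to a fixed node is binomial with mean 1/2, so it
equals `⌈c + 1⌉` with probability bounded below (`le_uniformProb_card_eq`). Such a node is
overloaded. For `z < 1` close to 1, `z ^ x v` then shrinks in expectation by a fixed factor per
ring, which no stationary distribution allows (`not_isStationary_uniformRouting`).

Stationarity: if every nonempty set `U` of nodes contains fewer than `2 * U.card` objects, summing
over the level sets of the queue vector bounds the sum of shorter queues by twice the total length,
minus the longest queue (`sum_min_add_sup_le`). The sum of squares therefore has negative drift away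
from a finite set, and a Foster–Lyapunov argument yields an invariant law
(`exists_bind_eq_self_of_drift`). A union bound over `U` and over the `2 * U.card` objects inside it
shows that the condition fails with probability at most `4 / m` (`card_denseHash_le`). -/

/-! ### Expectations and the Foster–Lyapunov criterion for discrete chains -/

namespace PMF

variable {α β : Type*}

/-- The expectation of a nonnegative function. -/
noncomputable def expect (μ : PMF α) (f : α → ℝ≥0∞) : ℝ≥0∞ := ∑' a, μ a * f a

theorem expect_pure (a : α) (f : α → ℝ≥0∞) : (pure a).expect f = f a := by
  classical
  rw [expect, tsum_eq_single a]
  · simp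
  · intro b hb
    simp [hb]

theorem expect_bind (μ : PMF α) (K : α → PMF β) (f : β → ℝ≥0∞) :
    (μ.bind K).expect f = μ.expect fun a => (K a).expect f := by
  simp only [expect, bind_apply, ← ENNReal.tsum_mul_right, ← ENNReal.tsum_mul_left, mul_assoc]
  exact ENNReal.tsum_comm

theorem expect_map (μ : PMF α) (g : α → β) (f : β → ℝ≥0∞) :
    (μ.map g).expect f = μ.expect fun a => f (g a) := by
  simp [← bind_pure_comp, expect_bind, expect_pure, Function.comp_def]

theorem expect_const (μ : PMF α) (c : ℝ≥0∞) : (μ.expect fun _ => c) = c := by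
  simp [expect, ENNReal.tsum_mul_right, μ.tsum_coe]

theorem expect_add (μ : PMF α) (f g : α → ℝ≥0∞) :
    (μ.expect fun a => f a + g a) = μ.expect f + μ.expect g := by
  simp only [expect, mul_add, ENNReal.tsum_add]

theorem expect_mul_right (μ : PMF α) (f : α → ℝ≥0∞) (c : ℝ≥0∞) :
    (μ.expect fun a => f a * c) = μ.expect f * c := by
  simp only [expect, ← ENNReal.tsum_mul_right, mul_assoc]

theorem expect_mul_left (μ : PMF α) (c : ℝ≥0∞) (f : α → ℝ≥0∞) :
    (μ.expect fun a => c * f a) = c * μ.expect f := by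
  simp only [mul_comm c, expect_mul_right]

theorem expect_mono (μ : PMF α) {f g : α → ℝ≥0∞} (h : ∀ a, f a ≤ g a) :
    μ.expect f ≤ μ.expect g :=
  ENNReal.tsum_le_tsum fun a => mul_le_mul_right (h a) _

theorem expect_eq_of_support (μ : PMF α) {f : α → ℝ≥0∞} {c : ℝ≥0∞}
    (h : ∀ a ∈ μ.support, f a = c) : μ.expect f = c := by
  rw [← μ.expect_const c]
  refine tsum_congr fun a => ?_
  by_cases ha : a ∈ μ.support
  · rw [h a ha]
  · rw [mem_support_iff, not_not] at ha
    simp [ha]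

/-- The law after `n` steps of the Markov chain with kernel `K` started from `x`. -/
noncomputable def iterate (K : α → PMF α) (x : α) : ℕ → PMF α
  | 0 => pure x
  | n + 1 => (iterate K x n).bind K

/-- The drift inequality telescopes along the chain. The decrease `f` is kept on the left because
subtraction in `ℝ≥0∞` is truncated. -/
theorem expect_iterate_add_sum_le {K : α → PMF α} {V f : α → ℝ≥0∞} {b : ℝ≥0∞} (x : α)
    (h : ∀ x, (K x).expect V + f x ≤ V x + b) (n : ℕ) :
    (iterate K x n).expect V + ∑ j ∈ Finset.range n, (iterate K x j).expect f ≤ V x + n * b := by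
  induction n with
  | zero => simp [iterate, expect_pure]
  | succ n ih =>
    calc (iterate K x (n + 1)).expect V + ∑ j ∈ Finset.range (n + 1), (iterate K x j).expect f
        = (iterate K x n).expect (fun a => (K a).expect V + f a) +
            ∑ j ∈ Finset.range n, (iterate K x j).expect f := by
          rw [Finset.sum_range_succ, expect_add, iterate, expect_bind]
          ring
      _ ≤ (iterate K x n).expect (fun a => V a + b) +
            ∑ j ∈ Finset.range n, (iterate K x j).expect f := by
          gcongr
          exact expect_mono _ h
      _ = ((iterate K x n).expect V + ∑ j ∈ Finset.range n, (iterate K x j).expect f) + b := by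
          rw [expect_add, expect_const]
          ring
      _ ≤ V x + n * b + b := by gcongr
      _ = V x + (n + 1 : ℕ) * b := by
          push_cast
          ring

/-- The average of the laws of a Markov chain at the times `0, …, n`. -/
noncomputable def cesaro (K : α → PMF α) (x : α) (n : ℕ) (a : α) : ℝ≥0∞ :=
  ((n + 1 : ℕ) : ℝ≥0∞)⁻¹ * ∑ j ∈ Finset.range (n + 1), iterate K x j a

theorem tsum_cesaro_mul (K : α → PMF α) (x : α) (n : ℕ) (f : α → ℝ≥0∞) :
    ∑' a, cesaro K x n a * f a =
      ((n + 1 : ℕ) : ℝ≥0∞)⁻¹ * ∑ j ∈ Finset.range (n + 1), (iterate K x j).expect f := by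
  simp only [cesaro, expect, mul_assoc, ENNReal.tsum_mul_left, Finset.sum_mul]
  rw [Summable.tsum_finsetSum fun _ _ => ENNReal.summable]

theorem tsum_cesaro (K : α → PMF α) (x : α) (n : ℕ) : ∑' a, cesaro K x n a = 1 := by
  have h := tsum_cesaro_mul K x n fun _ => 1
  simp only [mul_one, expect_const, Finset.sum_const, Finset.card_range, nsmul_eq_mul] at h
  rw [h]
  exact ENNReal.inv_mul_cancel (by simp) (by simp)

theorem tsum_cesaro_mul_le {K : α → PMF α} {V f : α → ℝ≥0∞} {b : ℝ≥0∞} (x : α)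
    (h : ∀ x, (K x).expect V + f x ≤ V x + b) (n : ℕ) :
    ∑' a, cesaro K x n a * f a ≤ V x + b := by
  rw [tsum_cesaro_mul]
  have h1 := le_add_self.trans (expect_iterate_add_sum_le x h (n + 1))
  calc _ ≤ ((n + 1 : ℕ) : ℝ≥0∞)⁻¹ * (V x + (n + 1 : ℕ) * b) := by gcongr
    _ = ((n + 1 : ℕ) : ℝ≥0∞)⁻¹ * V x + b := by
      rw [mul_add, ← mul_assoc, ENNReal.inv_mul_cancel (by simp) (by simp), one_mul]
    _ ≤ 1 * V x + b := by
      gcongr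
      simp
    _ = V x + b := by rw [one_mul]

/-- One step of `K` shifts the time window by one, so only the two end terms differ: Cesàro averages
are almost invariant. -/
theorem tsum_cesaro_mul_kernel_le (K : α → PMF α) (x : α) (n : ℕ) (y : α) :
    ∑' a, cesaro K x n a * K a y ≤ cesaro K x n y + ((n + 1 : ℕ) : ℝ≥0∞)⁻¹ := by
  rw [tsum_cesaro_mul, cesaro]
  have h : ∀ j, (iterate K x j).expect (fun a => K a y) = iterate K x (j + 1) y := fun j => rfl
  simp only [h]
  calc _ ≤ ((n + 1 : ℕ) : ℝ≥0∞)⁻¹ * (∑ j ∈ Finset.range (n + 1), iterate K x j y + 1) := by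
        gcongr
        calc _ ≤ ∑ j ∈ Finset.range (n + 1), iterate K x (j + 1) y + iterate K x 0 y :=
              le_self_add
          _ = ∑ j ∈ Finset.range (n + 1), iterate K x j y + iterate K x (n + 1) y := by
              rw [← Finset.sum_range_succ' fun j => iterate K x j y, Finset.sum_range_succ]
          _ ≤ _ := by
              gcongr
              exact coe_le_one _ _
    _ = _ := by rw [mul_add, mul_one]

open Filter Topology in
/-- A Markov chain with a Foster–Lyapunov function whose drift is bounded by a function with finite
sublevel sets has an invariant distribution. -/
theorem exists_bind_eq_self_of_drift {K : α → PMF α} {V f : α → ℝ≥0∞} {b : ℝ≥0∞} (hb : b ≠ ∞)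
    (x₀ : α) (hV : V x₀ ≠ ∞) (h : ∀ x, (K x).expect V + f x ≤ V x + b)
    (hf : ∀ C : ℝ≥0, {x | f x ≤ C}.Finite) : ∃ π : PMF α, π.bind K = π := by
  classical
  -- Compactness of `ℝ≥0∞` gives pointwise limits along an ultrafilter, replacing a diagonal
  -- subsequence.
  let U : Ultrafilter ℕ := hyperfilter ℕ
  have hlim : ∀ a, ∃ y, Tendsto (fun n => cesaro K x₀ n a) U (𝓝 y) := fun a =>
    ⟨_, (U.map fun n => cesaro K x₀ n a).le_nhds_lim⟩
  choose π hπ using hlim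
  have hsum : ∀ F : Finset α,
      Tendsto (fun n => ∑ a ∈ F, cesaro K x₀ n a) U (𝓝 (∑ a ∈ F, π a)) := fun F =>
    tendsto_finsetSum _ fun a _ => hπ a
  have hinv : Tendsto (fun n : ℕ => ((n + 1 : ℕ) : ℝ≥0∞)⁻¹) U (𝓝 0) :=
    (ENNReal.tendsto_inv_nat_nhds_zero.comp (tendsto_add_atTop_nat 1)).mono_left
      Nat.hyperfilter_le_atTop
  have hle : ∑' a, π a ≤ 1 := by
    rw [ENNReal.tsum_eq_iSup_sum]
    refine iSup_le fun F => le_of_tendsto' (hsum F) fun n => ?_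
    rw [← tsum_cesaro K x₀ n]
    exact ENNReal.sum_le_tsum F
  -- No mass escapes: by Markov's inequality the averages put at most `(V x₀ + b) / C ≤ ε` outside
  -- the finite set `{f ≤ C}`. The `+ 1` in `C` keeps it positive.
  have hge : 1 ≤ ∑' a, π a := by
    refine ENNReal.le_of_forall_pos_le_add fun ε hε _ => ?_
    obtain ⟨M, hM⟩ : ∃ M : ℝ≥0, (M : ℝ≥0∞) = V x₀ + b :=
      ⟨_, ENNReal.coe_toNNReal (ENNReal.add_ne_top.2 ⟨hV, hb⟩)⟩
    let C : ℝ≥0 := M / ε + 1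
    have hC : 0 < C := by positivity
    have hMC : M / C ≤ ε := by
      rw [div_le_iff₀ hC]
      have : ε * C = M + ε := by
        simp only [C]
        field_simp
      rw [this]
      exact le_self_add
    have key : ∀ n, (1 : ℝ≥0∞) ≤ ∑ a ∈ (hf C).toFinset, cesaro K x₀ n a + ε := by
      intro n
      have h1 : ∀ a, cesaro K x₀ n a ≤
          (if a ∈ (hf C).toFinset then cesaro K x₀ n a else 0) + cesaro K x₀ n a * f a / C := by
        intro a
        split_ifs with ha
        · exact le_self_add
        · simp only [Set.Finite.mem_toFinset, Set.mem_ofPred_eq, not_le] at ha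
          rw [zero_add, mul_div_assoc]
          refine le_mul_of_one_le_right' ?_
          rw [ENNReal.le_div_iff_mul_le (by simp [hC.ne']) (by simp), one_mul]
          exact ha.le
      calc (1 : ℝ≥0∞) = ∑' a, cesaro K x₀ n a := (tsum_cesaro _ _ _).symm
        _ ≤ _ := ENNReal.tsum_le_tsum h1
        _ = ∑ a ∈ (hf C).toFinset, cesaro K x₀ n a + (∑' a, cesaro K x₀ n a * f a) / C := by
          rw [ENNReal.tsum_add]
          congr 1
          · rw [tsum_eq_sum (s := (hf C).toFinset) fun a ha => if_neg ha]
            exact Finset.sum_congr rfl fun a ha => if_pos ha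
          · simp only [div_eq_mul_inv, ENNReal.tsum_mul_right]
        _ ≤ _ := by
          gcongr
          calc _ ≤ (V x₀ + b) / C := by
                gcongr
                exact tsum_cesaro_mul_le x₀ h n
            _ = ((M / C : ℝ≥0) : ℝ≥0∞) := by rw [← hM, ENNReal.coe_div hC.ne']
            _ ≤ ε := by exact_mod_cast hMC
    have := ge_of_tendsto' ((hsum (hf C).toFinset).add_const (ε : ℝ≥0∞)) key
    exact this.trans (by gcongr; exact ENNReal.sum_le_tsum _)
  have h1 : ∑' a, π a = 1 := le_antisymm hle hge
  let p : PMF α := ⟨π, h1 ▸ ENNReal.summable.hasSum⟩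
  have hpK : ∀ y, p.bind K y ≤ p y := by
    intro y
    rw [bind_apply, ENNReal.tsum_eq_iSup_sum]
    refine iSup_le fun F => ?_
    have hl : Tendsto (fun n => ∑ a ∈ F, cesaro K x₀ n a * K a y) U (𝓝 (∑ a ∈ F, π a * K a y)) :=
      tendsto_finsetSum _ fun a _ => ENNReal.Tendsto.mul_const (hπ a) (Or.inr ((K a).apply_ne_top y))
    have hr : Tendsto (fun n => cesaro K x₀ n y + ((n + 1 : ℕ) : ℝ≥0∞)⁻¹) U (𝓝 (π y)) := by
      simpa using (hπ y).add hinv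
    exact le_of_tendsto_of_tendsto' hl hr fun n =>
      (ENNReal.sum_le_tsum F).trans (tsum_cesaro_mul_kernel_le K x₀ n y)
  -- Passing to the limit gave only `≤`, but both sides have total mass 1, so no inequality can be
  -- strict.
  refine ⟨p, PMF.ext fun y => ?_⟩
  by_contra hne
  have hlt := ENNReal.tsum_lt_tsum (p.bind K).tsum_coe_ne_top hpK (lt_of_le_of_ne (hpK y) hne)
  rw [tsum_coe, tsum_coe] at hlt
  exact lt_irrefl _ hlt

end PMF

/-! ### From the jump chain to continuous time; instability of an overloaded node -/

namespace CacheSystem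

variable {k m : ℕ}

theorem expect_afterRing (sys : CacheSystem k m) (ρ : RoutingRule k m) (x : QueueState m)
    (f : QueueState m → ℝ≥0∞) :
    (sys.afterRing ρ x).expect f =
      ∑ e, ((sys.clockRate e / sys.totalRate : ℝ≥0) : ℝ≥0∞) * (ringEffect ρ x e).expect f := by
  rw [afterRing, PMF.expect_bind, PMF.expect, tsum_fintype]
  rfl

theorem sum_clockRate_div (sys : CacheSystem k m) :
    ∑ e, sys.clockRate e / sys.totalRate = 1 := by
  rw [← Finset.sum_div]
  exact div_self sys.totalRate_pos.ne'

/-- An invariant distribution of the embedded jump chain is stationary. -/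
theorem isStationary_of_bind_afterRing {sys : CacheSystem k m} {ρ : RoutingRule k m}
    {π : PMF (QueueState m)} (h : π.bind (sys.afterRing ρ) = π) : sys.IsStationary ρ := by
  have hn : ∀ n, π.bind (sys.afterRings ρ n) = π := by
    intro n
    induction n with
    | zero => exact PMF.bind_pure π
    | succ n ih =>
      simp only [afterRings]
      rw [← PMF.bind_bind]
      exact (congrArg (fun q => q.bind (sys.afterRing ρ)) ih).trans h
  refine ⟨π, fun t => ?_⟩
  change π.bind (fun x => (ProbabilityTheory.poissonMeasure (sys.totalRate * t)).toPMF.bind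
    fun n => sys.afterRings ρ n x) = π
  rw [PMF.bind_comm]
  simp only [hn, PMF.bind_const]

theorem expect_afterRings_le {sys : CacheSystem k m} {ρ : RoutingRule k m}
    {f : QueueState m → ℝ≥0∞} {θ : ℝ≥0∞} (h : ∀ x, (sys.afterRing ρ x).expect f ≤ θ * f x)
    (n : ℕ) (x : QueueState m) : (sys.afterRings ρ n x).expect f ≤ θ ^ n * f x := by
  induction n with
  | zero => simp [afterRings, PMF.expect_pure]
  | succ n ih =>
    rw [afterRings, PMF.expect_bind]
    calc _ ≤ (sys.afterRings ρ n x).expect fun y => θ * f y := PMF.expect_mono _ h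
      _ = θ * (sys.afterRings ρ n x).expect f := PMF.expect_mul_left _ _ _
      _ ≤ θ * (θ ^ n * f x) := by gcongr
      _ = θ ^ (n + 1) * f x := by ring

/-- A system with a bounded positive function that contracts in expectation has no stationary
distribution. -/
theorem not_isStationary_of_contraction {sys : CacheSystem k m} {ρ : RoutingRule k m}
    {f : QueueState m → ℝ≥0∞} {θ : ℝ≥0∞} (hθ : θ < 1) (hf : ∀ x, f x ≤ 1) (hf0 : ∀ x, f x ≠ 0)
    (h : ∀ x, (sys.afterRing ρ x).expect f ≤ θ * f x) : ¬ sys.IsStationary ρ := by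
  rintro ⟨π, hπ⟩
  -- Time 1 is enough. The contraction factor over it is the mean of `θ ^ n` for a Poisson `n`,
  -- which is below 1 because `n = 1` has positive mass.
  let ν : PMF ℕ := (ProbabilityTheory.poissonMeasure (sys.totalRate * 1)).toPMF
  have hν1 : ν 1 ≠ 0 := by
    simp only [ν, MeasureTheory.Measure.toPMF_apply, ProbabilityTheory.poissonMeasure_singleton]
    have := sys.totalRate_pos
    simp only [ne_eq, ENNReal.ofReal_eq_zero, not_le]
    positivity
  let κ : ℝ≥0∞ := ν.expect fun n => θ ^ n
  have hκ : κ < 1 := by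
    rw [← ν.tsum_coe]
    refine ENNReal.tsum_lt_tsum (i := 1) ?_ (fun n => ?_) ?_
    · exact ne_top_of_le_ne_top ν.tsum_coe_ne_top
        (ENNReal.tsum_le_tsum fun n => mul_le_of_le_one_right' (pow_le_one₀ zero_le hθ.le))
    · exact mul_le_of_le_one_right' (pow_le_one₀ zero_le hθ.le)
    · calc ν 1 * θ ^ 1 = ν 1 * θ := by rw [pow_one]
        _ < ν 1 * 1 := (ENNReal.mul_lt_mul_iff_right hν1 (ν.apply_ne_top 1)).2 hθ
        _ = ν 1 := mul_one _
  have hlaw : ∀ x, (sys.lawAt ρ 1 x).expect f ≤ κ * f x := by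
    intro x
    rw [lawAt, PMF.expect_bind, ← PMF.expect_mul_right]
    exact PMF.expect_mono _ fun n => expect_afterRings_le h n x
  have hM : π.expect f ≤ κ * π.expect f := by
    conv_lhs => rw [← hπ 1]
    rw [PMF.expect_bind, ← PMF.expect_mul_left]
    exact PMF.expect_mono _ hlaw
  have hMtop : π.expect f ≠ ∞ :=
    ne_top_of_le_ne_top ENNReal.one_ne_top ((π.expect_mono hf).trans_eq (π.expect_const 1))
  have hM0 : π.expect f ≠ 0 := by
    obtain ⟨x, hx⟩ := π.support_nonempty
    intro h0
    have := ENNReal.tsum_eq_zero.1 h0 x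
    exact mul_ne_zero hx (hf0 x) this
  have : κ * π.expect f < 1 * π.expect f :=
    (ENNReal.mul_lt_mul_iff_left hM0 hMtop).2 hκ
  rw [one_mul] at this
  exact absurd hM this.not_ge

/-- If the queries hashed to some node arrive faster than they are served, the system with the
uniform algorithm is not stationary. -/
theorem not_isStationary_uniformRouting (sys : CacheSystem k m) (h : Fin k → CacheNode m)
    (v : CacheNode m) (S : Finset (Fin k)) (hS : ∀ i ∈ S, h i = v)
    (hT : sys.T < ∑ i ∈ S, sys.p i * sys.R) : ¬ sys.IsStationary (uniformRouting h) := by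
  classical
  set l : ℝ≥0 := ∑ i, if h i = v then sys.p i * sys.R else 0 with hl
  have hTl : sys.T < l := by
    refine hT.trans_le ?_
    rw [hl, ← Finset.sum_filter]
    exact Finset.sum_le_sum_of_subset fun i hi => by simp [hS i hi]
  have hl0 : 0 < l := pos_of_gt hTl
  -- Arrivals at `v` multiply `z ^ x v` by `z`, services by at most `z⁻¹`. The net rate `(1 - z) *
  -- (T / z - l)` is negative exactly when `T / l < z < 1`.
  obtain ⟨z, hTz, hz1⟩ : ∃ z : ℝ≥0, sys.T / l < z ∧ z < 1 :=
    exists_between ((div_lt_one hl0).2 hTl)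
  have hz0 : 0 < z := pos_of_gt hTz
  rw [div_lt_iff₀ hl0] at hTz
  let g : Fin k ⊕ CacheNode m → ℝ≥0 :=
    Sum.elim (fun i => if h i = v then z else 1) (fun w => if w = v then z⁻¹ else 1)
  let θ : ℝ≥0 := ∑ e, sys.clockRate e / sys.totalRate * g e
  have hθ : θ < 1 := by
    simp only [θ, div_mul_eq_mul_div, ← Finset.sum_div]
    rw [div_lt_one sys.totalRate_pos, totalRate,
      Fintype.sum_sum_type fun e : Fin k ⊕ CacheNode m => sys.clockRate e * g e,
      Fintype.sum_sum_type fun e : Fin k ⊕ CacheNode m => sys.clockRate e]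
    simp only [clockRate, Sum.elim_inl, Sum.elim_inr, g]
    rw [← NNReal.coe_lt_coe]
    have e1 : ∀ i, ((sys.p i * sys.R * if h i = v then z else 1 : ℝ≥0) : ℝ) =
        (sys.p i * sys.R : ℝ≥0) - (1 - z) * (if h i = v then sys.p i * sys.R else 0 : ℝ≥0) := by
      intro i
      split_ifs <;> push_cast <;> ring
    have e2 : ∀ w : CacheNode m, ((sys.T * if w = v then z⁻¹ else 1 : ℝ≥0) : ℝ) =
        sys.T + (if w = v then (sys.T : ℝ) * ((z : ℝ)⁻¹ - 1) else 0) := by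
      intro w
      split_ifs <;> push_cast <;> ring
    rw [NNReal.coe_add, NNReal.coe_add, NNReal.coe_sum, NNReal.coe_sum, NNReal.coe_sum,
      NNReal.coe_sum, Finset.sum_congr rfl fun i _ => e1 i, Finset.sum_congr rfl fun w _ => e2 w,
      Finset.sum_sub_distrib, ← Finset.mul_sum, ← NNReal.coe_sum, ← NNReal.coe_sum, ← hl,
      Finset.sum_add_distrib, Finset.sum_ite_eq' Finset.univ v, if_pos (Finset.mem_univ v)]
    have hz0' : (0 : ℝ) < z := hz0
    have hz1' : (z : ℝ) < 1 := hz1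
    have hTz' : (sys.T : ℝ) < z * l := by exact_mod_cast hTz
    have e3 : (sys.T : ℝ) * ((z : ℝ)⁻¹ - 1) = (1 - z) * (sys.T / z) := by
      field_simp
    have e4 : (sys.T : ℝ) / z < l := by
      rw [div_lt_iff₀ hz0']
      linarith
    have e5 : (1 - (z : ℝ)) * (sys.T / z) < (1 - z) * l :=
      mul_lt_mul_of_pos_left e4 (by linarith)
    rw [e3]
    linarith
  refine not_isStationary_of_contraction (f := fun x => ((z ^ x v : ℝ≥0) : ℝ≥0∞)) (θ := θ)
    (by exact_mod_cast hθ) (fun x => ?_) (fun x => ?_) fun x => ?_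
  · exact_mod_cast pow_le_one₀ zero_le hz1.le
  · exact_mod_cast (pow_pos hz0 _).ne'
  · rw [expect_afterRing]
    simp only [θ, ENNReal.ofNNReal_finsetSum, Finset.sum_mul]
    refine Finset.sum_le_sum fun e _ => ?_
    rw [ENNReal.coe_mul, mul_assoc]
    gcongr
    rcases e with i | w
    · simp only [ringEffect, uniformRouting, PMF.pure_map, PMF.expect_pure, g, Sum.elim_inl]
      split_ifs with hi
      · subst hi
        rw [Function.update_self, pow_succ', ENNReal.coe_mul]
      · rw [Function.update_of_ne (Ne.symm hi), ENNReal.coe_one, one_mul]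
    · simp only [ringEffect, PMF.expect_pure, g, Sum.elim_inr]
      split_ifs with hw
      · subst hw
        rw [Function.update_self, ← ENNReal.coe_mul, ENNReal.coe_le_coe,
          le_inv_mul_iff₀ hz0, ← pow_succ']
        -- For an empty queue, truncated subtraction gives `x v - 1 + 1 = 1`; the inequality
        -- survives since `z ≤ 1`.
        exact pow_le_pow_of_le_one zero_le hz1.le (by omega)
      · rw [Function.update_of_ne (Ne.symm hw), ENNReal.coe_one, one_mul]

end CacheSystem

/-! ### Sparse hashing and the minimum of two queues -/

/-- The number of objects both of whose nodes lie in `U`. -/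
def numInside {k m : ℕ} (h₀ h₁ : Fin k → Fin m) (U : Finset (CacheNode m)) : ℕ :=
  (Finset.univ.filter fun i => Sum.inl (h₀ i) ∈ U ∧ Sum.inr (h₁ i) ∈ U).card

/-- If every nonempty set `U` of nodes contains fewer than `2 * U.card` objects, then the sum over
the objects of the shorter queues is less than twice the total queue length, by a margin that grows
with the longest queue. -/
theorem sum_min_add_sup_le {k m : ℕ} {h₀ h₁ : Fin k → Fin m}
    (hU : ∀ U : Finset (CacheNode m), U.Nonempty → numInside h₀ h₁ U < 2 * U.card) (n : ℕ)
    (x : QueueState m) (hx : Finset.univ.sup x = n) :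
    ∑ i, min (x (Sum.inl (h₀ i))) (x (Sum.inr (h₁ i))) + n ≤ 2 * ∑ v, x v := by
  induction n generalizing x with
  | zero =>
    have h0 : ∀ v, x v = 0 := fun v =>
      Nat.le_zero.1 (hx ▸ Finset.le_sup (f := x) (Finset.mem_univ v))
    simp [h0]
  | succ n ih =>
    have hsup : (Finset.univ.sup fun v => x v - 1) = n := by
      have := Finset.apply_sup_eq_sup_comp (s := Finset.univ) (f := x) (fun a : ℕ => a - 1)
        (fun a b => by simp only [Nat.max_def]; split_ifs <;> omega) rfl
      rw [hx] at this
      exact this.symm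
    -- Remove one query from every nonempty queue. The total drops by the size of the support, and
    -- the sum of minima by the number of objects inside the support. Strictness in `hU` contributes
    -- the extra 1 at each layer.
    have h1 := ih (fun v => x v - 1) hsup
    have hne : (Finset.univ.filter fun v => x v ≠ 0).Nonempty := by
      by_contra hcon
      rw [Finset.not_nonempty_iff_eq_empty, Finset.filter_eq_empty_iff] at hcon
      have : Finset.univ.sup x ≤ 0 :=
        Finset.sup_le fun v _ => (not_not.1 (hcon (Finset.mem_univ v))).le
      omega
    have h2 := hU _ hne
    have e1 : ∑ v, x v = ∑ v, (x v - 1) + (Finset.univ.filter fun v => x v ≠ 0).card := by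
      rw [Finset.card_filter, ← Finset.sum_add_distrib]
      exact Finset.sum_congr rfl fun v _ => by split_ifs <;> omega
    have e2 : ∑ i, min (x (Sum.inl (h₀ i))) (x (Sum.inr (h₁ i))) =
        ∑ i, min (x (Sum.inl (h₀ i)) - 1) (x (Sum.inr (h₁ i)) - 1) +
          numInside h₀ h₁ (Finset.univ.filter fun v => x v ≠ 0) := by
      rw [numInside, Finset.card_filter, ← Finset.sum_add_distrib]
      refine Finset.sum_congr rfl fun i _ => ?_
      simp only [Finset.mem_filter, Finset.mem_univ, true_and]
      split_ifs <;> omega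
    omega

/-! ### Quadratic drift under power-of-two-choices -/

namespace CacheSystem

variable {k m : ℕ}

/-- The quadratic Lyapunov function. -/
def sumSq (x : QueueState m) : ℕ := ∑ v, x v ^ 2

theorem sumSq_update (x : QueueState m) (v : CacheNode m) (a : ℕ) :
    sumSq (Function.update x v a) + x v ^ 2 = sumSq x + a ^ 2 := by
  rw [sumSq, sumSq, ← Finset.add_sum_erase _ _ (Finset.mem_univ v),
    ← Finset.add_sum_erase (a := v) _ (fun w => x w ^ 2) (Finset.mem_univ v),
    Function.update_self, Finset.sum_congr rfl fun w hw => by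
      rw [Function.update_of_ne (Finset.ne_of_mem_erase hw)]]
  ring

theorem eq_min_of_mem_support_potRouting {h₀ h₁ : Fin k → Fin m} {i : Fin k} {x : QueueState m}
    {v : CacheNode m} (hv : v ∈ (potRouting h₀ h₁ i x).support) :
    x v = min (x (Sum.inl (h₀ i))) (x (Sum.inr (h₁ i))) := by
  rw [potRouting] at hv
  split_ifs at hv with h1 h2
  · rw [PMF.mem_support_pure_iff] at hv
    rw [hv, min_eq_left h1.le]
  · rw [PMF.mem_support_pure_iff] at hv
    rw [hv, min_eq_right h2.le]
  · have h3 := le_antisymm (not_lt.1 h2) (not_lt.1 h1)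
    rw [PMF.mem_support_uniformOfFinset_iff, Finset.mem_insert, Finset.mem_singleton] at hv
    rcases hv with rfl | rfl
    · rw [min_eq_left h3.le]
    · rw [min_eq_right h3.ge]

/-- From `(a ± 1)² = a² ± 2a + 1`: an arrival adds twice the shorter queue plus 1, a service removes
twice the served queue up to 1. For an empty queue the slack 1 is simply unused. -/
theorem expect_ringEffect_potRouting_le (h₀ h₁ : Fin k → Fin m) (x : QueueState m)
    (e : Fin k ⊕ CacheNode m) :
    (ringEffect (potRouting h₀ h₁) x e).expect (fun y => (sumSq y : ℝ≥0∞)) +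
        (Sum.elim (fun _ => 0) (fun v => 2 * x v) e : ℕ) ≤
      (sumSq x + 1 : ℕ) +
        (Sum.elim (fun i => 2 * min (x (Sum.inl (h₀ i))) (x (Sum.inr (h₁ i)))) (fun _ => 0) e :
          ℕ) := by
  rcases e with i | v
  · rw [ringEffect, PMF.expect_map, PMF.expect_eq_of_support (c := ((sumSq x + 1 +
      2 * min (x (Sum.inl (h₀ i))) (x (Sum.inr (h₁ i))) : ℕ) : ℝ≥0∞))]
    · simp
    · intro v hv
      rw [← eq_min_of_mem_support_potRouting hv, Nat.cast_inj]
      have := sumSq_update x v (x v + 1)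
      nlinarith
  · rw [ringEffect, PMF.expect_pure]
    simp only [Sum.elim_inr, Nat.cast_zero, add_zero]
    rw [← Nat.cast_add, Nat.cast_le]
    have := sumSq_update x v (x v - 1)
    rcases hx : x v with _ | a
    · rw [hx] at this
      simp at this
      simp
      omega
    · rw [hx, Nat.add_sub_cancel] at this
      rw [Nat.add_sub_cancel]
      nlinarith

theorem sum_clockRate_div_mul {sys : CacheSystem k m} {r c : ℝ≥0}
    (hr : ∀ i, sys.p i * sys.R = r) (hT : sys.T = c * r) (a : Fin k → ℕ) (b : CacheNode m → ℕ) :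
    ∑ e, sys.clockRate e / sys.totalRate * ((Sum.elim a b e : ℕ) : ℝ≥0) =
      r / sys.totalRate * (∑ i, a i + c * ∑ v, b v : ℝ≥0) := by
  rw [Fintype.sum_sum_type fun e : Fin k ⊕ CacheNode m =>
    sys.clockRate e / sys.totalRate * ((Sum.elim a b e : ℕ) : ℝ≥0)]
  simp only [clockRate, Sum.elim_inl, Sum.elim_inr, hr, hT, ← Finset.mul_sum]
  push_cast
  ring

/-- Per ring, the expected change of `sumSq` is at most `1 + 2q (∑ min - c ∑ x)`, hence at most `1 -
2q sup x` by `sum_min_add_sup_le`, even at `c = 2`. Sublevel sets of `sup x` are finite, as the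
criterion requires. -/
theorem isStationary_potRouting (sys : CacheSystem k m) {r c : ℝ≥0}
    (hr : ∀ i, sys.p i * sys.R = r) (hr0 : 0 < r) (hT : sys.T = c * r) (hc : 2 ≤ c)
    (h₀ h₁ : Fin k → Fin m)
    (hU : ∀ U : Finset (CacheNode m), U.Nonempty → numInside h₀ h₁ U < 2 * U.card) :
    sys.IsStationary (potRouting h₀ h₁) := by
  set q : ℝ≥0 := r / sys.totalRate with hq
  have hq0 : 0 < q := div_pos hr0 sys.totalRate_pos
  have hdrift : ∀ x, (sys.afterRing (potRouting h₀ h₁) x).expect (fun y => (sumSq y : ℝ≥0∞)) +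
      ((q * (2 * (Finset.univ.sup x : ℕ)) : ℝ≥0) : ℝ≥0∞) ≤ (sumSq x : ℝ≥0∞) + 1 := by
    intro x
    let s : ℕ := ∑ i, 2 * min (x (Sum.inl (h₀ i))) (x (Sum.inr (h₁ i)))
    let t : ℕ := ∑ v, 2 * x v
    have hst : s + 2 * Finset.univ.sup x ≤ 2 * t := by
      have := sum_min_add_sup_le hU _ x rfl
      simp only [s, t, ← Finset.mul_sum]
      omega
    have hst' : q * s + q * (2 * (Finset.univ.sup x : ℕ)) ≤ q * (c * t) := by
      rw [← mul_add]
      gcongr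
      calc (s : ℝ≥0) + 2 * (Finset.univ.sup x : ℕ) ≤ 2 * t := by exact_mod_cast hst
        _ ≤ c * t := by gcongr
    have h1 := Finset.sum_le_sum fun e (_ : e ∈ Finset.univ) =>
      mul_le_mul_right (expect_ringEffect_potRouting_le h₀ h₁ x e)
        ((sys.clockRate e / sys.totalRate : ℝ≥0) : ℝ≥0∞)
    simp only [mul_add, Finset.sum_add_distrib] at h1
    rw [← expect_afterRing, ← Finset.sum_mul, ← ENNReal.ofNNReal_finsetSum, sum_clockRate_div,
      ENNReal.coe_one, one_mul] at h1
    simp only [← ENNReal.coe_natCast (Sum.elim _ _ _), ← ENNReal.coe_mul,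
      ← ENNReal.ofNNReal_finsetSum, sum_clockRate_div_mul hr hT] at h1
    have h2 := (add_le_add_right (ENNReal.coe_le_coe.2 hst')
      ((sys.afterRing (potRouting h₀ h₁) x).expect fun y => (sumSq y : ℝ≥0∞))).trans
        (le_trans (le_of_eq ?_) h1)
    · rw [ENNReal.coe_add, ← add_assoc, add_right_comm] at h2
      -- The arrival term `q * s` stands on both sides and is finite, so it cancels.
      refine (ENNReal.add_le_add_iff_right (a := ((q * s : ℝ≥0) : ℝ≥0∞)) ENNReal.coe_ne_top).1
        (h2.trans_eq ?_)
      simp [s, hq]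
    · simp [t, hq]
  have hfin : ∀ C : ℝ≥0, {x : QueueState m |
      ((q * (2 * (Finset.univ.sup x : ℕ)) : ℝ≥0) : ℝ≥0∞) ≤ C}.Finite := by
    intro C
    refine (Set.finite_Iic (fun _ : CacheNode m => ⌊C / (q * 2)⌋₊)).subset fun x hx v => ?_
    simp only [Set.mem_ofPred_eq, ENNReal.coe_le_coe] at hx
    have hv : x v ≤ Finset.univ.sup x := Finset.le_sup (Finset.mem_univ v)
    refine hv.trans (Nat.le_floor ?_)
    rw [le_div_iff₀ (by positivity)]
    calc _ = q * (2 * (Finset.univ.sup x : ℕ)) := by ring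
      _ ≤ C := hx
  obtain ⟨π, hπ⟩ := PMF.exists_bind_eq_self_of_drift ENNReal.one_ne_top (fun _ => 0)
    (by simp) hdrift hfin
  exact isStationary_of_bind_afterRing hπ

end CacheSystem

/-! ### Counting hash functions: the load of one node -/

theorem card_div_le_uniformProb {Ω : Type*} [Finite Ω] {E : Set Ω} (F : Finset Ω)
    (h : (F : Set Ω) ⊆ E) : (F.card : ℝ) / Nat.card Ω ≤ uniformProb E := by
  rw [uniformProb, ← Set.ncard_coe_finset]
  gcongr
  exact E.toFinite

theorem uniformProb_mono {Ω : Type*} [Finite Ω] {E F : Set Ω} (h : E ⊆ F) :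
    uniformProb E ≤ uniformProb F := by
  rw [uniformProb, uniformProb]
  gcongr
  exact F.toFinite

theorem one_sub_card_div_le_uniformProb {Ω : Type*} [Finite Ω] [Nonempty Ω] {E : Set Ω}
    (F : Finset Ω) (h : Eᶜ ⊆ F) : 1 - (F.card : ℝ) / Nat.card Ω ≤ uniformProb E := by
  have h1 : (Eᶜ.ncard : ℝ) ≤ F.card := by
    rw [← Set.ncard_coe_finset]
    exact_mod_cast Set.ncard_le_ncard h
  have h2 : (E.ncard : ℝ) + Eᶜ.ncard = Nat.card Ω := by exact_mod_cast E.ncard_add_ncard_compl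
  have h3 : (0 : ℝ) < Nat.card Ω := by exact_mod_cast Nat.card_pos
  rw [uniformProb, sub_le_iff_le_add, ← add_div, one_le_div h3]
  linarith

theorem card_piFinset_ite {k : ℕ} {β : Type*} (S : Finset (Fin k)) (A B : Finset β) :
    (Fintype.piFinset fun i => if i ∈ S then A else B).card =
      A.card ^ S.card * B.card ^ (k - S.card) := by
  rw [Fintype.card_piFinset, ← Finset.prod_mul_prod_compl S,
    Finset.prod_congr rfl fun i hi => by rw [if_pos hi],
    Finset.prod_congr (s₁ := Sᶜ) rfl fun i hi => by rw [if_neg (Finset.mem_compl.1 hi)],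
    Finset.prod_const, Finset.prod_const, Finset.card_compl, Fintype.card_fin]

/-- The number of functions that take the value `v` exactly `K` times. -/
theorem choose_mul_le_card_filter {k K : ℕ} {β : Type*} [Fintype β] [DecidableEq β] (v : β) :
    k.choose K * (Fintype.card β - 1) ^ (k - K) ≤
      (Finset.univ.filter fun h : Fin k → β =>
        (Finset.univ.filter fun i => h i = v).card = K).card := by
  let G : Finset (Fin k) → Finset (Fin k → β) := fun S =>
    Fintype.piFinset fun i => if i ∈ S then {v} else Finset.univ.erase v
  have hG : ∀ S h, h ∈ G S → (Finset.univ.filter fun i => h i = v) = S := by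
    intro S h hh
    ext i
    have := Fintype.mem_piFinset.1 hh i
    simp only [Finset.mem_filter, Finset.mem_univ, true_and]
    split_ifs at this with hi
    · simpa [hi] using this
    · simpa [hi] using this
  calc k.choose K * (Fintype.card β - 1) ^ (k - K)
      = ∑ S ∈ Finset.powersetCard K (Finset.univ : Finset (Fin k)), (G S).card := by
        rw [Finset.sum_congr rfl fun S hS => by
          rw [card_piFinset_ite, (Finset.mem_powersetCard.1 hS).2, Finset.card_singleton, one_pow,
            one_mul, Finset.card_erase_of_mem (Finset.mem_univ v), Finset.card_univ],
          Finset.sum_const, Finset.card_powersetCard, Finset.card_univ, Fintype.card_fin,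
          smul_eq_mul]
    _ = ((Finset.powersetCard K Finset.univ).biUnion G).card := by
        rw [Finset.card_biUnion]
        intro S _ S' _ hne
        refine Finset.disjoint_left.2 fun h hh hh' => hne ?_
        rw [← hG S h hh, hG S' h hh']
    _ ≤ _ := by
        refine Finset.card_le_card fun h hh => ?_
        obtain ⟨S, hS, hh⟩ := Finset.mem_biUnion.1 hh
        simp only [Finset.mem_filter, Finset.mem_univ, true_and, hG S h hh]
        exact (Finset.mem_powersetCard.1 hS).2

/-- A fixed node receives exactly `K` of the `m` objects with probability bounded below. -/
theorem le_uniformProb_card_eq {m K : ℕ} (hm0 : 0 < m) (hm : 2 * K ≤ m) (v : CacheNode m) :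
    (1 / 4 : ℝ) ^ K / K.factorial / 2 ≤ uniformProb {h : Fin m → CacheNode m |
      (Finset.univ.filter fun i => h i = v).card = K} := by
  refine le_trans ?_ (card_div_le_uniformProb (Finset.univ.filter fun h : Fin m → CacheNode m =>
    (Finset.univ.filter fun i => h i = v).card = K) (fun h hh => by simpa using hh))
  have hmR : (0 : ℝ) < m := by exact_mod_cast hm0
  have hcard : Fintype.card (CacheNode m) = 2 * m := by
    rw [Fintype.card_sum, Fintype.card_fin]
    ring
  have h1 := choose_mul_le_card_filter (k := m) (K := K) v
  rw [hcard] at h1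
  have h2 : ((m.choose K : ℝ) * (2 * m - 1) ^ (m - K)) ≤ ((Finset.univ.filter
      fun h : Fin m → CacheNode m => (Finset.univ.filter fun i => h i = v).card = K).card : ℝ) := by
    have : ((2 * m - 1 : ℕ) : ℝ) = 2 * m - 1 := by
      rw [Nat.cast_sub (by omega)]
      push_cast
      ring
    rw [← this]
    exact_mod_cast h1
  have hcard' : (Nat.card (Fin m → CacheNode m) : ℝ) = (2 * m) ^ m := by
    rw [Nat.card_eq_fintype_card, Fintype.card_fun, hcard, Fintype.card_fin]
    push_cast
    ring
  -- Bernoulli: `(1 - 1/(2m)) ^ (m - K) ≥ 1 - (m - K)/(2m) ≥ 1/2`.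
  have hbern : (1 / 2 : ℝ) * (2 * m) ^ (m - K) ≤ (2 * m - 1) ^ (m - K) := by
    have hb := one_add_mul_le_pow (a := -(1 / (2 * (m : ℝ)))) (by
      have : 1 / (2 * (m : ℝ)) ≤ 1 := by
        rw [div_le_one (by positivity)]
        have : (1 : ℝ) ≤ m := by exact_mod_cast hm0
        linarith
      linarith) (m - K)
    have hle : ((m - K : ℕ) : ℝ) * (1 / (2 * m)) ≤ 1 / 2 := by
      have : ((m - K : ℕ) : ℝ) ≤ m := by exact_mod_cast Nat.sub_le m K
      rw [mul_one_div, div_le_iff₀ (by positivity)]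
      linarith
    have he : (2 * (m : ℝ) - 1) = (1 + -(1 / (2 * m))) * (2 * m) := by
      field_simp
      ring
    rw [he, mul_pow (1 + _) (2 * (m : ℝ))]
    exact mul_le_mul_of_nonneg_right (by linarith) (by positivity)
  have hchoose : ((m : ℝ) / 2) ^ K / K.factorial ≤ m.choose K := by
    refine le_trans ?_ (Nat.pow_le_choose K m)
    gcongr
    rw [div_le_iff₀ (by norm_num)]
    have : m ≤ (m + 1 - K) * 2 := by omega
    exact_mod_cast this
  rw [hcard', le_div_iff₀ (by positivity)]
  refine le_trans ?_ h2
  calc (1 / 4 : ℝ) ^ K / K.factorial / 2 * (2 * m) ^ m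
      = ((m : ℝ) / 2) ^ K / K.factorial * (1 / 2 * (2 * m) ^ (m - K)) := by
        have e1 : (2 * (m : ℝ)) ^ m = (2 * m) ^ K * (2 * m) ^ (m - K) := by
          rw [← pow_add, Nat.add_sub_cancel' (by omega)]
        have e2 : ((m : ℝ) / 2) ^ K = (1 / 4) ^ K * (2 * m) ^ K := by
          rw [← mul_pow]
          congr 1
          ring
        rw [e1, e2]
        ring
    _ ≤ _ := by gcongr

/-! ### Union bound over dense sets of nodes -/

theorem choose_le_three_mul_div_pow (n u : ℕ) : (n.choose u : ℝ) ≤ (3 * n / u) ^ u := by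
  rcases Nat.eq_zero_or_pos u with rfl | hu
  · simp
  have hu' : (0 : ℝ) < u := by exact_mod_cast hu
  have h1 : (u : ℝ) ^ u / u.factorial ≤ 3 ^ u :=
    (Real.pow_div_factorial_le_exp _ hu'.le u).trans (by
      rw [← Real.exp_one_pow]
      exact pow_le_pow_left₀ (Real.exp_pos 1).le Real.exp_one_lt_three.le u)
  calc (n.choose u : ℝ) ≤ (n : ℝ) ^ u / u.factorial := Nat.choose_le_pow_div u n
    _ = (n / u : ℝ) ^ u * (u ^ u / u.factorial) := by
      rw [div_pow]
      field_simp
    _ ≤ (n / u : ℝ) ^ u * 3 ^ u := by gcongr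
    _ = (3 * n / u) ^ u := by
      rw [← mul_pow]
      congr 1
      ring

theorem sum_range_mul_half_pow_le (n : ℕ) : ∑ u ∈ Finset.range n, (u : ℝ) * (1 / 2) ^ u ≤ 2 := by
  have h : ∑ u ∈ Finset.range n, (u : ℝ) * (1 / 2) ^ u = 2 - 2 * (n + 1) * (1 / 2) ^ n := by
    induction n with
    | zero => simp
    | succ n ih =>
      rw [Finset.sum_range_succ, ih]
      push_cast
      ring
  rw [h]
  have : (0 : ℝ) ≤ 2 * (n + 1) * (1 / 2) ^ n := by positivity
  linarith

/-- This is the share of the union bound due to node sets of size `u`. It is at most `(27/32 * u/m)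
^ u`, where `27/32 = 6 * (3/2)² / 2⁴`, and `2u ≤ m` makes the base less than 1/2. -/
theorem choose_mul_choose_mul_pow_le {m u : ℕ} (hm : 0 < m) (hu : 0 < u) :
    ((2 * m).choose u : ℝ) * (m.choose (2 * u) * (u / (2 * m)) ^ (4 * u)) ≤
      2 / m * (u * (1 / 2) ^ u) := by
  have hm' : (0 : ℝ) < m := by exact_mod_cast hm
  have hu' : (0 : ℝ) < u := by exact_mod_cast hu
  rcases lt_or_ge m (2 * u) with h | h
  · rw [Nat.choose_eq_zero_of_lt h]
    simp only [Nat.cast_zero, zero_mul, mul_zero]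
    positivity
  have h' : (2 : ℝ) * u ≤ m := by exact_mod_cast h
  -- One factor is kept as `u / m`, the source of the decay in `m`; the other `u - 1` are bounded by
  -- 1/2.
  obtain ⟨w, rfl⟩ : ∃ w, u = w + 1 := ⟨u - 1, by omega⟩
  set z : ℝ := ((w + 1 : ℕ) : ℝ) with hz
  calc _ ≤ (3 * (2 * m : ℕ) / z) ^ (w + 1) *
        ((3 * m / (2 * (w + 1) : ℕ)) ^ (2 * (w + 1)) * (z / (2 * m)) ^ (4 * (w + 1))) := by
        gcongr
        · exact choose_le_three_mul_div_pow _ _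
        · exact choose_le_three_mul_div_pow _ _
    _ = (27 / 32 * z / m) ^ w * (27 / 32 * z / m) := by
        rw [pow_mul, pow_mul, ← mul_pow, ← mul_pow, ← pow_succ]
        congr 1
        rw [Nat.cast_mul 2 (w + 1), ← hz]
        push_cast
        field_simp
        norm_num
    _ ≤ (1 / 2) ^ w * (z / m) := by
        gcongr ?_ ^ w * ?_
        · rw [div_le_iff₀ hm']
          linarith
        · gcongr
          linarith
    _ = _ := by
        rw [pow_succ]
        ring

/-- The pairs of hash functions that send every object in `S` into `U` twice. -/
def hashInside {m : ℕ} (U : Finset (CacheNode m)) (S : Finset (Fin m)) :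
    Finset ((Fin m → Fin m) × (Fin m → Fin m)) :=
  (Fintype.piFinset fun i => if i ∈ S then Finset.univ.filter (Sum.inl · ∈ U) else Finset.univ) ×ˢ
    Fintype.piFinset fun i => if i ∈ S then Finset.univ.filter (Sum.inr · ∈ U) else Finset.univ

/-- If `U` has `s` upper and `t` lower nodes, an object falls inside with probability `s * t / m²`,
at most `(U.card / (2m))²` by AM-GM. The `2 * U.card` objects of `S` are independent. -/
theorem card_hashInside_le {m : ℕ} (hm : 0 < m) (U : Finset (CacheNode m)) (S : Finset (Fin m))
    (hS : S.card = 2 * U.card) :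
    ((hashInside U S).card : ℝ) ≤ (U.card / (2 * m) : ℝ) ^ (4 * U.card) * (m : ℝ) ^ (2 * m) := by
  have hm' : (0 : ℝ) < m := by exact_mod_cast hm
  have hSm : 2 * U.card ≤ m := by
    rw [← hS]
    simpa using S.card_le_univ
  set s := (Finset.univ.filter fun a : Fin m => (Sum.inl a : CacheNode m) ∈ U).card with hs
  set t := (Finset.univ.filter fun a : Fin m => (Sum.inr a : CacheNode m) ∈ U).card with ht
  have hst : s + t = U.card := by
    rw [hs, ht, Finset.card_filter, Finset.card_filter,
      ← Fintype.sum_sum_type fun v : CacheNode m => if v ∈ U then 1 else 0, ← Finset.card_filter,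
      Finset.filter_univ_mem]
  have hst' : (s : ℝ) + t = U.card := by exact_mod_cast hst
  rw [hashInside, Finset.card_product, card_piFinset_ite, card_piFinset_ite, hS, Finset.card_univ,
    Fintype.card_fin, ← hs, ← ht]
  push_cast
  have hprod : (s : ℝ) * t ≤ (U.card / 2) ^ 2 := by
    rw [← hst']
    nlinarith [sq_nonneg ((s : ℝ) - t)]
  calc (s : ℝ) ^ (2 * U.card) * m ^ (m - 2 * U.card) * (t ^ (2 * U.card) * m ^ (m - 2 * U.card))
      = (s * t : ℝ) ^ (2 * U.card) * m ^ (2 * (m - 2 * U.card)) := by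
        rw [mul_pow, two_mul (m - 2 * U.card), pow_add]
        ring
    _ ≤ ((U.card / 2 : ℝ) ^ 2) ^ (2 * U.card) * m ^ (2 * (m - 2 * U.card)) := by gcongr
    _ = (U.card / (2 * m) : ℝ) ^ (4 * U.card) * (m : ℝ) ^ (2 * m) := by
        have e : (m : ℝ) ^ (2 * m) = m ^ (4 * U.card) * m ^ (2 * (m - 2 * U.card)) := by
          rw [← pow_add]
          congr 1
          omega
        rw [e, ← pow_mul, ← mul_assoc (_ ^ _) (_ ^ _), ← mul_pow (U.card / (2 * m) : ℝ)]
        congr 2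
        · field_simp
        · ring

/-- The pairs of hash functions for which some nonempty set `U` of nodes contains at least
`2 * U.card` objects. -/
def denseHash (m : ℕ) : Finset ((Fin m → Fin m) × (Fin m → Fin m)) :=
  (Finset.univ.filter Finset.Nonempty).biUnion fun U : Finset (CacheNode m) =>
    (Finset.powersetCard (2 * U.card) Finset.univ).biUnion (hashInside U)

theorem numInside_lt_of_notMem_denseHash {m : ℕ} {h : (Fin m → Fin m) × (Fin m → Fin m)}
    (hh : h ∉ denseHash m) (U : Finset (CacheNode m)) (hU : U.Nonempty) :
    numInside h.1 h.2 U < 2 * U.card := by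
  by_contra hcon
  obtain ⟨S, hSsub, hS⟩ := Finset.exists_subset_card_eq (not_lt.1 hcon)
  refine hh (Finset.mem_biUnion.2 ⟨U, by simpa using hU, Finset.mem_biUnion.2
    ⟨S, Finset.mem_powersetCard.2 ⟨Finset.subset_univ _, hS⟩, ?_⟩⟩)
  rw [hashInside, Finset.mem_product, Fintype.mem_piFinset, Fintype.mem_piFinset]
  refine ⟨fun i => ?_, fun i => ?_⟩
  · split_ifs with hi
    · simpa using (Finset.mem_filter.1 (hSsub hi)).2.1
    · exact Finset.mem_univ _
  · split_ifs with hi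
    · simpa using (Finset.mem_filter.1 (hSsub hi)).2.2
    · exact Finset.mem_univ _

theorem card_denseHash_le {m : ℕ} (hm : 0 < m) :
    ((denseHash m).card : ℝ) ≤ 4 / m * (m : ℝ) ^ (2 * m) := by
  -- The formula would give 1 at `u = 0`; the value 0 lets the sum run over all `U`, the empty set
  -- included.
  let g : ℕ → ℝ := fun u =>
    if u = 0 then 0 else m.choose (2 * u) * (u / (2 * m)) ^ (4 * u)
  have hU : ∀ U : Finset (CacheNode m), U.Nonempty →
      (((Finset.powersetCard (2 * U.card) Finset.univ).biUnion (hashInside U)).card : ℝ) ≤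
        g U.card * (m : ℝ) ^ (2 * m) := by
    intro U hU
    calc _ ≤ ((∑ S ∈ Finset.powersetCard (2 * U.card) Finset.univ, (hashInside U S).card : ℕ) : ℝ) :=
          by exact_mod_cast Finset.card_biUnion_le
      _ ≤ ∑ S ∈ Finset.powersetCard (2 * U.card) (Finset.univ : Finset (Fin m)),
            (U.card / (2 * m) : ℝ) ^ (4 * U.card) * (m : ℝ) ^ (2 * m) := by
          rw [Nat.cast_sum]
          exact Finset.sum_le_sum fun S hS =>
            card_hashInside_le hm U S (Finset.mem_powersetCard.1 hS).2
      _ = g U.card * (m : ℝ) ^ (2 * m) := by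
          simp only [g, if_neg hU.card_pos.ne', Finset.sum_const, Finset.card_powersetCard,
            Finset.card_univ, Fintype.card_fin, nsmul_eq_mul]
          ring
  have hg : ∀ u, 0 ≤ g u := fun u => by
    simp only [g]
    split_ifs <;> positivity
  have hcard : (Finset.univ : Finset (CacheNode m)).card = 2 * m := by
    rw [Finset.card_univ, Fintype.card_sum, Fintype.card_fin]
    ring
  calc ((denseHash m).card : ℝ)
      ≤ ((∑ U ∈ (Finset.univ.filter Finset.Nonempty : Finset (Finset (CacheNode m))),
          ((Finset.powersetCard (2 * U.card) Finset.univ).biUnion (hashInside U)).card : ℕ) : ℝ) := by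
        exact_mod_cast Finset.card_biUnion_le
    _ ≤ ∑ U ∈ (Finset.univ.filter Finset.Nonempty : Finset (Finset (CacheNode m))),
          g U.card * (m : ℝ) ^ (2 * m) := by
        rw [Nat.cast_sum]
        exact Finset.sum_le_sum fun U hU' => hU U (Finset.mem_filter.1 hU').2
    _ ≤ ∑ U ∈ (Finset.univ : Finset (CacheNode m)).powerset, g U.card * (m : ℝ) ^ (2 * m) :=
        Finset.sum_le_sum_of_subset_of_nonneg (by simp) fun U _ _ =>
          mul_nonneg (hg _) (by positivity)
    _ = (∑ u ∈ Finset.range (2 * m + 1), (2 * m).choose u * g u) * (m : ℝ) ^ (2 * m) := by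
        rw [← Finset.sum_mul, Finset.sum_powerset_apply_card, hcard]
        simp only [nsmul_eq_mul]
    _ ≤ (∑ u ∈ Finset.range (2 * m + 1), 2 / m * ((u : ℝ) * (1 / 2) ^ u)) * (m : ℝ) ^ (2 * m) := by
        gcongr ?_ * _
        refine Finset.sum_le_sum fun u _ => ?_
        rcases Nat.eq_zero_or_pos u with rfl | hu
        · simp [g]
        · simp only [g, if_neg hu.ne']
          exact choose_mul_choose_mul_pow_le hm hu
    _ ≤ (2 / m * 2) * (m : ℝ) ^ (2 * m) := by
        rw [← Finset.mul_sum]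
        gcongr
        exact sum_range_mul_half_pow_le _
    _ = _ := by ring

/-! ### Assembling the two statements -/

theorem CacheSystem.rate_pos {m : ℕ} (sys : CacheSystem m m) {r : ℝ≥0}
    (hr : ∀ i, sys.p i * sys.R = r) : 0 < r := by
  rw [pos_iff_ne_zero]
  rintro rfl
  have h : (∑ i, sys.p i) * sys.R = 0 := by rw [Finset.sum_mul, Finset.sum_eq_zero fun i _ => hr i]
  rw [sys.sum_p, one_mul] at h
  exact sys.R_pos.ne' h

theorem mainTheorem4 :
    (∀ c : ℝ≥0, 0 < c → ∃ δ : ℝ, 0 < δ ∧ ∃ m₀ : ℕ, ∀ m : ℕ, m₀ ≤ m →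
      ∀ (r : ℝ≥0) (sys : CacheSystem m m), (∀ i, sys.p i * sys.R = r) → sys.T = c * r →
        δ ≤ uniformProb {h : Fin m → CacheNode m | ¬ sys.IsStationary (uniformRouting h)} ∧
        ∀ v : CacheNode m,
          δ ≤ uniformProb {h : Fin m → CacheNode m |
            (∃ S : Finset (Fin m), c + 1 ≤ (S.card : ℝ≥0) ∧ (∀ i ∈ S, h i = v) ∧
              sys.T < ∑ i ∈ S, sys.p i * sys.R) ∧
            ¬ sys.IsStationary (uniformRouting h)}) ∧
    (∀ c : ℝ≥0, 2 ≤ c → ∀ ε : ℝ, 0 < ε → ∃ m₀ : ℕ, ∀ m : ℕ, m₀ ≤ m →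
      ∀ (r : ℝ≥0) (sys : CacheSystem m m), (∀ i, sys.p i * sys.R = r) → sys.T = c * r →
        1 - ε ≤ uniformProb {h : (Fin m → Fin m) × (Fin m → Fin m) |
          sys.IsStationary (potRouting h.1 h.2)}) := by
  refine ⟨fun c _ => ?_, fun c hc ε hε => ?_⟩
  · let K : ℕ := ⌈c + 1⌉₊
    -- `2 * K + 1 ≤ m` supplies both `2 * K ≤ m` and `0 < m` for `le_uniformProb_card_eq`.
    refine ⟨(1 / 4 : ℝ) ^ K / K.factorial / 2, by positivity, 2 * K + 1,
      fun m hm r sys hr hT => ?_⟩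
    have hr0 := sys.rate_pos hr
    have key : ∀ v : CacheNode m, (1 / 4 : ℝ) ^ K / K.factorial / 2 ≤
        uniformProb {h : Fin m → CacheNode m |
          (∃ S : Finset (Fin m), c + 1 ≤ (S.card : ℝ≥0) ∧ (∀ i ∈ S, h i = v) ∧
            sys.T < ∑ i ∈ S, sys.p i * sys.R) ∧ ¬ sys.IsStationary (uniformRouting h)} := by
      intro v
      refine (le_uniformProb_card_eq (by omega) (by omega) v).trans
        (uniformProb_mono fun h hh => ?_)
      simp only [Set.mem_ofPred_eq] at hh
      have hK : c + 1 ≤ ((Finset.univ.filter fun i => h i = v).card : ℝ≥0) := by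
        rw [hh]
        exact Nat.le_ceil _
      have hS : ∀ i ∈ Finset.univ.filter (fun i => h i = v), h i = v := fun i hi =>
        (Finset.mem_filter.1 hi).2
      have hload : sys.T < ∑ i ∈ Finset.univ.filter (fun i => h i = v), sys.p i * sys.R := by
        simp only [hr, hT, Finset.sum_const, nsmul_eq_mul]
        exact mul_lt_mul_of_pos_right ((lt_add_one c).trans_le hK) hr0
      exact ⟨⟨_, hK, hS, hload⟩, sys.not_isStationary_uniformRouting h v _ hS hload⟩
    exact ⟨(key (Sum.inl ⟨0, by omega⟩)).trans (uniformProb_mono fun h hh => hh.2), key⟩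
  -- This makes the failure probability `4 / m` at most `ε`.
  · refine ⟨⌈4 / ε⌉₊ + 1, fun m hm r sys hr hT => ?_⟩
    have hm0 : 0 < m := by omega
    have hm' : (0 : ℝ) < m := by exact_mod_cast hm0
    have : Nonempty (Fin m) := ⟨⟨0, hm0⟩⟩
    refine le_trans ?_ (one_sub_card_div_le_uniformProb (denseHash m) fun h hh => ?_)
    · have hN : (Nat.card ((Fin m → Fin m) × (Fin m → Fin m)) : ℝ) = (m : ℝ) ^ (2 * m) := by
        rw [Nat.card_prod, Nat.card_fun, Nat.card_fin, two_mul, pow_add]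
        push_cast
        rfl
      have hε' : 4 / (m : ℝ) ≤ ε := by
        have h1 : 4 / ε ≤ m := (Nat.le_ceil _).trans (by exact_mod_cast (by omega))
        rw [div_le_iff₀ hε] at h1
        rw [div_le_iff₀ hm']
        linarith
      have h2 := card_denseHash_le hm0
      rw [hN, sub_le_sub_iff_left, div_le_iff₀ (by positivity)]
      exact h2.trans (by gcongr)
    · by_contra hnot
      exact hh (sys.isStationary_potRouting hr (sys.rate_pos hr) hT hc h.1 h.2
        (numInside_lt_of_notMem_denseHash hnot))
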